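/- Let $d\ge 1$ be an integer and let $\mathcal S_d$ be the symmetric group on $\{1,\dots,d\}$, permutations being composed from right to left. Let $\Sigma_d$ be the monoid generated by symbols $x_\sigma$, $\sigma\in\mathcal S_d$, subject to the relations $x_{\mathbf 1}=1$ and $x_\sigma\cdot x_\tau=x_\tau\cdot x_{\tau^{-1}\sigma\tau}=x_{\sigma\tau\sigma^{-1}}\cdot x_\sigma$ for all $\sigma,\tau\in\mathcal S_d$ (the factorization semigroup of $\mathcal S_d$). Let $\alpha:\Sigma_d\to\mathcal S_d$ be the homomorphism with $\alpha(x_\sigma)=\sigma$, let $ln:\Sigma_d\to\mathbb Z_{\ge 0}$ be the homomorphism with $ln(x_\sigma)=1$ for $\sigma\neq\mathbf 1$ and $ln(x_{\mathbf 1})=0$, and let $S_{T_d}\subset\Sigma_d$ be the submonoid generated by the $x_\tau$ with $\tau$ a transposition. For $s=x_{\tau_1}\cdots x_{\tau_n}\in\Sigma_d$ the subgroup of $\mathcal S_d$ generated by $\tau_1,\dots,\tau_n$ depends only on $s$; denote it by $(\mathcal S_d)_s$. The regenerating homomorphism $r:\Sigma_d\to S_{T_d}$ is the homomorphism that sends $x_\sigma$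 to the product, over the cycles $(i_1,\dots,i_p)$ with $p\ge 2$ of $\sigma$, of the pairwise commuting elements $x_{(i_1,i_2)}\cdot x_{(i_2,i_3)}\cdots x_{(i_{p-1},i_p)}$ (each of which depends only on the cycle $i_1\mapsto i_2\mapsto\cdots\mapsto i_p\mapsto i_1$). Put $ln_t(s)=ln(r(s))$; for $\sigma$ with cycles of lengths $k_1,\dots,k_n\ge 2$ this gives $ln_t(x_\sigma)=\sum_{i=1}^n(k_i-1)$. For a permutation $\sigma$ with cycles of lengths $k_1\ge\dots\ge k_n\ge 2$, the canonical representative of its cycle type is the permutation $(1,\dots,k_1)(k_1+1,\dots,k_1+k_2)\cdots\left(\sum_{i<n}k_i+1,\dots,\sum_{i\le n}k_i\right)$ (it is $\mathbf 1$ for $\sigma=\mathbf 1$). For $g\ge 0$ the Hurwitz element of genus $g$ is $$h_{d,g}=(x_{(1,2)}^2)^{g+1}\cdot x_{(2,3)}^2\cdots x_{(d-1,d)}^2\in\Sigma_d$$ (the empty product, i.e. $1$, if $d=1$). **Theorem 2.3.** Let $m\ge 0$, let $\sigma_1,\dots,\sigma_m\in\mathcal S_d$, let $\bar s\in S_{T_d}$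 be of length $ln(\bar s)=k$, and let $s=x_{\sigma_1}\cdots x_{\sigma_m}\cdot\bar s\in\Sigma_d$. Let $\sigma_{j,0}$ be the canonical representative of the cycle type of $\sigma_j$, and put $\sigma=(\sigma_{1,0}\cdots\sigma_{m,0})^{-1}\alpha(s)$. If $(\mathcal S_d)_s=\mathcal S_d$ and $k\ge 3(d-1)$, then the number $$g=\frac{k-ln_t(x_\sigma)}{2}-d+1$$ is a non-negative integer and $$s=x_{\sigma_{1,0}}\cdots x_{\sigma_{m,0}}\cdot r(x_\sigma)\cdot h_{d,g}.$$ -/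

import Mathlib

/-- Defining relations of the factorization semigroup of `G` with factors in `G`: the generator of
the unity is the unity, and `x_a · x_b = x_b · x_{b⁻¹ab} = x_{aba⁻¹} · x_a`. -/
inductive FactRel (G : Type) [Group G] : FreeMonoid G → FreeMonoid G → Prop
  | unit : FactRel G (FreeMonoid.of 1) 1
  | left (a b : G) : FactRel G (FreeMonoid.of a * FreeMonoid.of b)
      (FreeMonoid.of b * FreeMonoid.of (b⁻¹ * a * b))
  | right (a b : G) : FactRel G (FreeMonoid.of a * FreeMonoid.of b)
      (FreeMonoid.of (a * b * a⁻¹) * FreeMonoid.of a)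

/-- The universal factorization semigroup `S(G, G)` (a monoid, with unity `x_1`). -/
abbrev FactSemigroup (G : Type) [Group G] : Type := PresentedMonoid (FactRel G)

namespace FactSemigroup

variable {G : Type} [Group G]

/-- The generator `x_g`. -/
def x (g : G) : FactSemigroup G := PresentedMonoid.of (FactRel G) g

theorem x_one : x (1 : G) = 1 := PresentedMonoid.mk_eq_mk_of_rel FactRel.unit

theorem x_mul_x_left (a b : G) : x a * x b = x b * x (b⁻¹ * a * b) :=
  PresentedMonoid.mk_eq_mk_of_rel (FactRel.left a b)

theorem x_mul_x_right (a b : G) : x a * x b = x (a * b * a⁻¹) * x a :=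
  PresentedMonoid.mk_eq_mk_of_rel (FactRel.right a b)

/-- The universal property: maps of the generators that respect the relations. -/
def liftHom {M : Type} [Monoid M] (f : G → M) (h1 : f 1 = 1)
    (hr : ∀ a b, f a * f b = f (a * b * a⁻¹) * f a) : FactSemigroup G →* M :=
  PresentedMonoid.lift f (by
    intro u v h
    cases h with
    | unit => simpa using h1
    | left a b =>
      have := hr b (b⁻¹ * a * b)
      simp only [map_mul, FreeMonoid.lift_eval_of]
      rw [this]
      congr 2
      group
    | right a b => simpa using hr a b)

theorem liftHom_x {M : Type} [Monoid M] (f : G → M) (h1 : f 1 = 1)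
    (hr : ∀ a b, f a * f b = f (a * b * a⁻¹) * f a) (g : G) : liftHom f h1 hr (x g) = f g := rfl

/-- The product homomorphism `α : x_g ↦ g`. -/
def alpha : FactSemigroup G →* G := liftHom id rfl (by intro a b; simp)

theorem alpha_x (g : G) : alpha (x g) = g := rfl

open Classical in
/-- The length, as a homomorphism to the additive monoid `ℕ`: each `x_g` with `g ≠ 1` counts for
one, and `x_1` counts for zero. -/
noncomputable def lnHom : FactSemigroup G →* Multiplicative ℕ :=
  liftHom (fun g => Multiplicative.ofAdd (if g = 1 then 0 else 1)) (by simp) (by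
    intro a b
    have : a * b * a⁻¹ = 1 ↔ b = 1 := conj_eq_one_iff
    simp only [this]
    rw [mul_comm])

/-- The length `ln(s)`. -/
noncomputable def ln (s : FactSemigroup G) : ℕ := Multiplicative.toAdd (lnHom s)

/-- The subgroup `G_s` generated by the factors `g_1, …, g_n` of `s = x_{g_1} ⋯ x_{g_n}` (all
presentations of `s` are allowed here; `factorSubgroup_prod` says that each of them gives the same
subgroup). -/
def factorSubgroup (s : FactSemigroup G) : Subgroup G :=
  Subgroup.closure {g | ∃ w : List G, (w.map x).prod = s ∧ g ∈ w}

theorem mk_eq_prod (w : FreeMonoid G) :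
    PresentedMonoid.mk (FactRel G) w = (w.toList.map x).prod := by
  induction w with
  | one => simp
  | of a => simp [x, PresentedMonoid.of]
  | mul u v hu hv => simp [hu, hv]

/-- Two words are related if their letters generate the same subgroup. -/
def subgroupCon (G : Type) [Group G] : Con (FreeMonoid G) where
  r u v := Subgroup.closure {g | g ∈ u.toList} = Subgroup.closure {g | g ∈ v.toList}
  iseqv := ⟨fun _ => rfl, fun h => h.symm, fun h h' => h.trans h'⟩
  mul' := by
    intro u u' v v' h h'
    simp only [FreeMonoid.toList_mul, List.mem_append, Set.ofPred_or, Subgroup.closure_union]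
    rw [h, h']

theorem subgroupCon_of_rel (u v : FreeMonoid G) (h : FactRel G u v) : subgroupCon G u v := by
  change Subgroup.closure {g | g ∈ u.toList} = Subgroup.closure {g | g ∈ v.toList}
  cases h with
  | unit => simp
  | left a b =>
    have e1 : {g | g ∈ (FreeMonoid.of a * FreeMonoid.of b).toList} = ({a, b} : Set G) := by
      ext g; simp
    have e2 : {g | g ∈ (FreeMonoid.of b * FreeMonoid.of (b⁻¹ * a * b)).toList}
        = ({b, b⁻¹ * a * b} : Set G) := by
      ext g; simp
    rw [e1, e2]
    apply le_antisymm <;> rw [Subgroup.closure_le] <;> rintro g (rfl | rfl)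
    · have hb : b ∈ Subgroup.closure ({b, b⁻¹ * g * b} : Set G) :=
        Subgroup.subset_closure (by simp)
      have hc : b⁻¹ * g * b ∈ Subgroup.closure ({b, b⁻¹ * g * b} : Set G) :=
        Subgroup.subset_closure (by simp)
      have := mul_mem (mul_mem hb hc) (inv_mem hb)
      have e : b * (b⁻¹ * g * b) * b⁻¹ = g := by group
      rwa [e] at this
    · exact Subgroup.subset_closure (by simp)
    · exact Subgroup.subset_closure (by simp)
    · have ha : a ∈ Subgroup.closure ({a, b} : Set G) := Subgroup.subset_closure (by simp)
      have hb : b ∈ Subgroup.closure ({a, b} : Set G) := Subgroup.subset_closure (by simp)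
      exact mul_mem (mul_mem (inv_mem hb) ha) hb
  | right a b =>
    have e1 : {g | g ∈ (FreeMonoid.of a * FreeMonoid.of b).toList} = ({a, b} : Set G) := by
      ext g; simp
    have e2 : {g | g ∈ (FreeMonoid.of (a * b * a⁻¹) * FreeMonoid.of a).toList}
        = ({a * b * a⁻¹, a} : Set G) := by
      ext g; simp
    rw [e1, e2]
    apply le_antisymm <;> rw [Subgroup.closure_le] <;> rintro g (rfl | rfl)
    · exact Subgroup.subset_closure (by simp)
    · have ha : a ∈ Subgroup.closure ({a * g * a⁻¹, a} : Set G) :=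
        Subgroup.subset_closure (by simp)
      have hc : a * g * a⁻¹ ∈ Subgroup.closure ({a * g * a⁻¹, a} : Set G) :=
        Subgroup.subset_closure (by simp)
      have := mul_mem (mul_mem (inv_mem ha) hc) ha
      have e : a⁻¹ * (a * g * a⁻¹) * a = g := by group
      rwa [e] at this
    · have ha : a ∈ Subgroup.closure ({a, b} : Set G) := Subgroup.subset_closure (by simp)
      have hb : b ∈ Subgroup.closure ({a, b} : Set G) := Subgroup.subset_closure (by simp)
      exact mul_mem (mul_mem ha hb) (inv_mem ha)
    · exact Subgroup.subset_closure (by simp)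

theorem closure_eq_of_prod_eq (w w' : List G) (h : (w.map x).prod = (w'.map x).prod) :
    Subgroup.closure {g | g ∈ w} = Subgroup.closure {g | g ∈ w'} := by
  have h' : PresentedMonoid.mk (FactRel G) (FreeMonoid.ofList w)
      = PresentedMonoid.mk (FactRel G) (FreeMonoid.ofList w') := by
    rw [mk_eq_prod, mk_eq_prod]; exact h
  have h2 := PresentedMonoid.mk_eq_mk_iff.1 h'
  exact (Con.conGen_le (c := subgroupCon G)).2 subgroupCon_of_rel h2

theorem factorSubgroup_prod (w : List G) :
    factorSubgroup (w.map x).prod = Subgroup.closure {g | g ∈ w} := by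
  apply le_antisymm
  · refine (Subgroup.closure_le _).2 ?_
    rintro g ⟨w', hw', hg⟩
    rw [← closure_eq_of_prod_eq w' w hw']
    exact Subgroup.subset_closure hg
  · exact Subgroup.closure_mono fun g hg => ⟨w, rfl, hg⟩

/-- Simultaneous conjugation `x_a ↦ x_{g a g⁻¹}`. -/
def rho (g : G) : FactSemigroup G →* FactSemigroup G :=
  liftHom (fun a => x (g * a * g⁻¹)) (by simp [x_one]) (by
    intro a b
    rw [x_mul_x_right]
    congr 2
    group)

theorem rho_x (g a : G) : rho g (x a) = x (g * a * g⁻¹) := rfl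

theorem induction_x {p : FactSemigroup G → Prop} (s : FactSemigroup G) (h1 : p 1)
    (hm : ∀ g t, p t → p (x g * t)) : p s := by
  obtain ⟨w, rfl⟩ := PresentedMonoid.surjective_mk s
  rw [mk_eq_prod]
  induction w.toList with
  | nil => simpa using h1
  | cons a l ih => simpa using hm a _ ih

theorem rho_mul (g h : G) (s : FactSemigroup G) : rho (g * h) s = rho g (rho h s) := by
  induction s using induction_x with
  | h1 => simp
  | hm a t ih =>
    rw [map_mul, map_mul, map_mul, ih, rho_x, rho_x, rho_x]
    congr 2
    group

theorem rho_one (s : FactSemigroup G) : rho (1 : G) s = s := by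
  induction s using induction_x with
  | h1 => simp
  | hm a t ih => rw [map_mul, ih, rho_x]; simp

theorem mul_eq_rho_mul (s t : FactSemigroup G) : s * t = rho (alpha s) t * s := by
  have key : ∀ (g : G) (t : FactSemigroup G), x g * t = rho g t * x g := by
    intro g t
    induction t using induction_x with
    | h1 => simp
    | hm a t ih => rw [map_mul, rho_x, ← mul_assoc, x_mul_x_right, mul_assoc, ih,
      ← mul_assoc]
  induction s using induction_x with
  | h1 => simp [rho_one]
  | hm a s ih =>
    rw [mul_assoc, ih, ← mul_assoc, key, map_mul, alpha_x, rho_mul, mul_assoc]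

end FactSemigroup

/-- The semigroup `Σ_d`. -/
abbrev SymFact (d : ℕ) : Type := FactSemigroup (Equiv.Perm (Fin d))

namespace SymFact

open FactSemigroup

variable {d : ℕ}

/-- The subsemigroup `S_{T_d}` of `Σ_d` generated by the `x_τ`, `τ` a transposition. -/
def transp (d : ℕ) : Submonoid (SymFact d) :=
  Submonoid.closure {s | ∃ τ : Equiv.Perm (Fin d), τ.IsSwap ∧ s = x τ}

/-- `x_{(i₁,i₂)} · x_{(i₂,i₃)} ⋯ x_{(i_{k-1},i_k)}` for the list `[i₁, …, i_k]`; its product is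
the cyclic permutation `i₁ ↦ i₂ ↦ … ↦ i_k ↦ i₁`. -/
def pathWord (l : List (Fin d)) : SymFact d :=
  (List.zipWith (fun a b => x (Equiv.swap a b)) l l.tail).prod

theorem pathWord_cons_cons (a b : Fin d) (l : List (Fin d)) :
    pathWord (a :: b :: l) = x (Equiv.swap a b) * pathWord (b :: l) := rfl

theorem alpha_pathWord (l : List (Fin d)) : alpha (pathWord l) = l.formPerm := by
  induction l with
  | nil => simp [pathWord]
  | cons a l ih =>
    cases l with
    | nil => simp [pathWord]
    | cons b l => rw [pathWord_cons_cons, map_mul, ih, alpha_x, List.formPerm_cons_cons]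

theorem rho_pathWord (g : Equiv.Perm (Fin d)) (l : List (Fin d)) :
    rho g (pathWord l) = pathWord (l.map g) := by
  induction l with
  | nil => simp [pathWord]
  | cons a l ih =>
    cases l with
    | nil => simp [pathWord]
    | cons b l =>
      rw [pathWord_cons_cons, map_mul, ih, rho_x]
      simp only [List.map_cons]
      rw [pathWord_cons_cons]
      congr 2
      rw [Equiv.swap_apply_apply]

theorem pathWord_mem (l : List (Fin d)) (hl : l.Nodup) : pathWord l ∈ transp d := by
  induction l with
  | nil => simp [pathWord]
  | cons a l ih =>
    cases l with
    | nil => simp [pathWord]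
    | cons b l =>
      rw [pathWord_cons_cons]
      refine mul_mem (Submonoid.subset_closure ⟨_, ⟨a, b, ?_, rfl⟩, rfl⟩) (ih hl.of_cons)
      rintro rfl
      simp at hl

theorem pathWord_append_pair (l : List (Fin d)) (a b : Fin d) :
    pathWord (l ++ [a, b]) = pathWord (l ++ [a]) * x (Equiv.swap a b) := by
  induction l with
  | nil => simp [pathWord]
  | cons c l ih =>
    cases l with
    | nil => simp [pathWord]
    | cons e l =>
      simp only [List.cons_append] at ih ⊢
      rw [pathWord_cons_cons, pathWord_cons_cons, ih, mul_assoc]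

theorem pathWord_rotate_one (a : Fin d) (l : List (Fin d)) (hl : (a :: l).Nodup) :
    pathWord (l ++ [a]) = pathWord (a :: l) := by
  rcases List.eq_nil_or_concat l with rfl | ⟨l', c, rfl⟩
  · rfl
  · simp only [List.concat_eq_append, List.append_assoc, List.cons_append, List.nil_append] at *
    rw [pathWord_append_pair, mul_eq_rho_mul, rho_x, alpha_pathWord]
    cases l' with
    | nil => simp [pathWord, Equiv.swap_comm]
    | cons b l' =>
      simp only [List.cons_append] at *
      rw [pathWord_cons_cons]
      congr 2
      rw [← Equiv.swap_apply_apply]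
      have h1 : (b :: (l' ++ [c])).formPerm c = b := by
        have := List.formPerm_apply_getLast b (l' ++ [c])
        rwa [List.getLast_cons (by simp), List.getLast_append_singleton] at this
      have h2 : (b :: (l' ++ [c])).formPerm a = a :=
        List.formPerm_apply_of_notMem (List.nodup_cons.1 hl).1
      rw [h1, h2, Equiv.swap_comm]

theorem pathWord_isRotated {l l' : List (Fin d)} (h : l.IsRotated l') (hl : l.Nodup) :
    pathWord l = pathWord l' := by
  obtain ⟨n, rfl⟩ := h
  induction n generalizing l with
  | zero => simp
  | succ n ih =>
    cases l with
    | nil => simp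
    | cons a l =>
      rw [List.rotate_cons_succ, ← pathWord_rotate_one a l hl]
      refine ih ?_
      rw [List.nodup_append_comm]
      exact hl

/-- The element of `S_{T_d}` attached to a cyclic permutation `c = (i₁, …, i_k)`, written with
`i₁` the smallest of the `i_j`. -/
def cycleElt (c : Equiv.Perm (Fin d)) : SymFact d :=
  if h : c.support.Nonempty then pathWord (c.toList (c.support.min' h)) else 1

theorem cycleElt_eq {c : Equiv.Perm (Fin d)} (hc : c.IsCycle) {a : Fin d} (ha : a ∈ c.support) :
    cycleElt c = pathWord (c.toList a) := by
  have h : c.support.Nonempty := ⟨a, ha⟩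
  rw [cycleElt, dif_pos h]
  refine pathWord_isRotated ?_ (Equiv.Perm.nodup_toList _ _)
  exact (hc.sameCycle (Equiv.Perm.mem_support.1 (Finset.min'_mem _ h))
    (Equiv.Perm.mem_support.1 ha)).toList_isRotated

theorem cycleElt_mem (c : Equiv.Perm (Fin d)) : cycleElt c ∈ transp d := by
  unfold cycleElt
  split_ifs
  · exact pathWord_mem _ (Equiv.Perm.nodup_toList _ _)
  · exact one_mem _

theorem alpha_cycleElt {c : Equiv.Perm (Fin d)} (hc : c.IsCycle) : alpha (cycleElt c) = c := by
  obtain ⟨a, ha⟩ := hc.nonempty_support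
  rw [cycleElt_eq hc ha, alpha_pathWord, Equiv.Perm.formPerm_toList,
    hc.cycleOf_eq (Equiv.Perm.mem_support.1 ha)]

theorem toList_conj (g c : Equiv.Perm (Fin d)) (a : Fin d) :
    (g * c * g⁻¹).toList (g a) = (c.toList a).map g := by
  have hp : ∀ n : ℕ, (g * c * g⁻¹) ^ n = g * c ^ n * g⁻¹ := fun n => conj_pow
  have hcard : ((g * c * g⁻¹).cycleOf (g a)).support.card = (c.cycleOf a).support.card := by
    have e : (g * c * g⁻¹).cycleOf (g a) = g * c.cycleOf a * g⁻¹ := by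
      ext1 y
      rw [Equiv.Perm.cycleOf_apply]
      have : Equiv.Perm.SameCycle (g * c * g⁻¹) (g a) y ↔ Equiv.Perm.SameCycle c a (g⁻¹ y) := by
        rw [Equiv.Perm.sameCycle_conj]; simp
      simp only [this, Equiv.Perm.mul_apply, Equiv.Perm.cycleOf_apply]
      split_ifs <;> simp
    rw [e, Equiv.Perm.card_support_conj]
  apply List.ext_getElem
  · simp only [Equiv.Perm.length_toList, List.length_map, hcard]
  · intro n h1 h2
    rw [Equiv.Perm.getElem_toList, List.getElem_map, Equiv.Perm.getElem_toList, hp]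
    simp

theorem rho_cycleElt (g : Equiv.Perm (Fin d)) {c : Equiv.Perm (Fin d)} (hc : c.IsCycle) :
    rho g (cycleElt c) = cycleElt (g * c * g⁻¹) := by
  obtain ⟨a, ha⟩ := hc.nonempty_support
  have hga : g a ∈ (g * c * g⁻¹).support := by
    rw [Equiv.Perm.mem_support] at ha ⊢
    simpa using ha
  rw [cycleElt_eq hc ha, cycleElt_eq (hc.conj) hga, toList_conj, rho_pathWord]

theorem cycleElt_commute (σ : Equiv.Perm (Fin d)) :
    (σ.cycleFactorsFinset : Set (Equiv.Perm (Fin d))).Pairwise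
      (Function.onFun Commute (cycleElt (d := d))) := by
  intro c hc c' hc' hne
  have hcc := (Equiv.Perm.mem_cycleFactorsFinset_iff.1 hc).1
  have hcc' := (Equiv.Perm.mem_cycleFactorsFinset_iff.1 hc').1
  have hd := Equiv.Perm.cycleFactorsFinset_pairwise_disjoint σ hc hc' hne
  change cycleElt c * cycleElt c' = cycleElt c' * cycleElt c
  rw [mul_eq_rho_mul, alpha_cycleElt hcc, rho_cycleElt c hcc']
  congr 2
  rw [hd.commute.eq, mul_inv_cancel_right]

/-- The element `s(σ)` of `S_{T_d}`: the product of the elements attached to the cycles of `σ`. -/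
noncomputable def regenElt (σ : Equiv.Perm (Fin d)) : SymFact d :=
  σ.cycleFactorsFinset.noncommProd cycleElt (cycleElt_commute σ)

theorem regenElt_mem (σ : Equiv.Perm (Fin d)) : regenElt σ ∈ transp d :=
  Submonoid.noncommProd_mem _ _ _ _ fun c _ => cycleElt_mem c

theorem alpha_regenElt (σ : Equiv.Perm (Fin d)) : alpha (regenElt σ) = σ := by
  rw [regenElt, Finset.map_noncommProd]
  conv_rhs => rw [← Equiv.Perm.cycleFactorsFinset_noncommProd σ]
  exact Finset.noncommProd_congr rfl
    (fun c hc => alpha_cycleElt (Equiv.Perm.mem_cycleFactorsFinset_iff.1 hc).1) _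

theorem rho_regenElt (g σ : Equiv.Perm (Fin d)) :
    rho g (regenElt σ) = regenElt (g * σ * g⁻¹) := by
  have hset : (g * σ * g⁻¹).cycleFactorsFinset
      = σ.cycleFactorsFinset.map (MulAut.conj g).toEquiv.toEmbedding := by
    ext c
    have := Equiv.Perm.mem_cycleFactorsFinset_conj σ g (g⁻¹ * c * g)
    have e : g * (g⁻¹ * c * g) * g⁻¹ = c := by group
    rw [e] at this
    rw [this, Finset.mem_map_equiv]
    simp [MulAut.conj_symm_apply]
  rw [regenElt, Finset.map_noncommProd, regenElt]
  have h2 : ∀ c ∈ σ.cycleFactorsFinset, rho g (cycleElt c) = cycleElt (g * c * g⁻¹) :=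
    fun c hc => rho_cycleElt g (Equiv.Perm.mem_cycleFactorsFinset_iff.1 hc).1
  unfold Finset.noncommProd
  congr 1
  rw [hset, Finset.map_val, Multiset.map_map]
  exact Multiset.map_congr rfl fun c hc => h2 c hc

/-- The regenerating homomorphism `r : Σ_d → S_{T_d}`, `r(x_σ) = s(σ)`. -/
noncomputable def regen (d : ℕ) : SymFact d →* transp d :=
  liftHom (fun σ => ⟨regenElt σ, regenElt_mem σ⟩)
    (by
      apply Subtype.ext
      change regenElt (1 : Equiv.Perm (Fin d)) = (1 : SymFact d)
      unfold regenElt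
      exact (Finset.noncommProd_congr Equiv.Perm.cycleFactorsFinset_one (fun _ _ => rfl) _).trans
        (Finset.noncommProd_empty _ _))
    (by
      intro a b
      apply Subtype.ext
      change regenElt a * regenElt b = regenElt (a * b * a⁻¹) * regenElt a
      rw [mul_eq_rho_mul, alpha_regenElt, rho_regenElt])

/-- The transposition length `ln_t(s) = ln(r(s))`. -/
noncomputable def lnt (s : SymFact d) : ℕ := ln (regen d s : SymFact d)

/-- The product of the cycles on consecutive blocks of lengths `k₁, k₂, …`, the first block
starting at the position `o` (positions are numbered from `0`). -/
def blockPerm (d : ℕ) : ℕ → List ℕ → Equiv.Perm (Fin d)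
  | _, [] => 1
  | o, k :: ks =>
      ((List.finRange d).filter (fun i => decide (o ≤ i.val ∧ i.val < o + k))).formPerm
        * blockPerm d (o + k) ks

/-- The canonical representative
`(1, …, k₁)(k₁ + 1, …, k₁ + k₂) ⋯` of the type `[k₁ ≥ k₂ ≥ …]` of `σ`. -/
def canonicalRep (σ : Equiv.Perm (Fin d)) : Equiv.Perm (Fin d) :=
  blockPerm d 0 (σ.cycleType.sort (· ≥ ·))

/-- The Hurwitz element `h_{d,g} = (x_{(1,2)}²)^{g+1} · x_{(2,3)}² ⋯ x_{(d-1,d)}²`. -/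
def hurwitz (d g : ℕ) : SymFact d :=
  (List.ofFn fun i : Fin (d - 1) =>
    (x (Equiv.swap (⟨i.val, by omega⟩ : Fin d) ⟨i.val + 1, by omega⟩) ^ 2)
      ^ (if i.val = 0 then g + 1 else 1)).prod

end SymFact

/-! ### Central squares in a factorization semigroup -/

namespace FactSemigroup

variable {G : Type} [Group G]

/-! If `t` is an involution, `x t ^ 2` has trivial product and is therefore central. Moving it past
another factor `x a` both ways shows that it may be replaced by the square of `a * t * a⁻¹`; hence
`t` may be conjugated by anything in the group generated by the other factors (`mul_square_conj`).

Multiplying a regenerated permutation by a transposition either joins two cycles, which again gives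
a regenerated permutation, or cuts a cycle, which splits off a square (`x_mul_regenElt`). So every
product `T` of transpositions is `regenElt (alpha T)` times central squares. The regenerated part
has length at most `d - 1`, so the bound `3 (d - 1)` on the length of `T` leaves at least `d - 1`
squares.

When all factors together generate the symmetric group, that many squares suffice to turn `d - 1` of
them, one at a time, into the squares of the adjacent transpositions: a matroid-style exchange
(`exists_exchange`), with orbit counts playing the part of rank. These squares alone generate the
group, so every further square can be made `x_{(1,2)}²`, and the squares form a Hurwitz element.

The same normal form treats the factors `x σ_j`. It offers a square `x τ ^ 2` for each adjacent `τ`;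
placed next to `x σ`, the square conjugates `σ` by `τ` and leaves two transpositions. The length of
the transposition part is unchanged, so this can be repeated until every `σ_j` is canonical
(`exists_conj_factor`). Comparing images under `alpha` identifies the remaining product as `σ`, and
comparing lengths gives `g`. -/

theorem exists_word (u : FactSemigroup G) : ∃ w : List G, (w.map x).prod = u := by
  obtain ⟨w, rfl⟩ := PresentedMonoid.surjective_mk u
  exact ⟨w.toList, (mk_eq_prod w).symm⟩

theorem factorSubgroup_mul (u v : FactSemigroup G) :
    factorSubgroup (u * v) = factorSubgroup u ⊔ factorSubgroup v := by
  obtain ⟨w, rfl⟩ := exists_word u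
  obtain ⟨w', rfl⟩ := exists_word v
  rw [← List.prod_append, ← List.map_append, factorSubgroup_prod, factorSubgroup_prod,
    factorSubgroup_prod, ← Subgroup.closure_union]
  congr 1
  ext g
  simp

theorem factorSubgroup_one : factorSubgroup (1 : FactSemigroup G) = ⊥ := by
  simpa using factorSubgroup_prod (G := G) []

theorem factorSubgroup_x (a : G) : factorSubgroup (x a) = Subgroup.closure {a} := by
  simpa using factorSubgroup_prod [a]

theorem ln_mul (u v : FactSemigroup G) : ln (u * v) = ln u + ln v := by
  simp [ln]

theorem ln_one : ln (1 : FactSemigroup G) = 0 := by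
  simp [ln]

theorem ln_x {a : G} (ha : a ≠ 1) : ln (x a) = 1 := by
  simp [ln, lnHom, liftHom_x, ha]

/-- Used to carry spare transpositions to the right past the factors that must stay in place. -/
theorem mul_eq_mul_rho (s t : FactSemigroup G) : s * t = t * rho (alpha t)⁻¹ s := by
  rw [mul_eq_rho_mul t, ← rho_mul, mul_inv_cancel, rho_one]

/-- An element with trivial product is central. -/
theorem commute_of_alpha_eq_one {c : FactSemigroup G} (hc : alpha c = 1) (u : FactSemigroup G) :
    Commute c u := by
  change c * u = u * c
  rw [mul_eq_rho_mul, hc, rho_one]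

theorem alpha_square {t : G} (ht : t ^ 2 = 1) : alpha (x t ^ 2) = 1 := by
  rw [map_pow, alpha_x, ht]

theorem conj_sq_eq_one {t : G} (ht : t ^ 2 = 1) (g : G) : (g * t * g⁻¹) ^ 2 = 1 := by
  rw [conj_pow, ht]
  group

/-- A central square may be conjugated by the group generated by the other factors. -/
theorem mul_square_conj (u : FactSemigroup G) {g : G} (hg : g ∈ factorSubgroup u) :
    ∀ t : G, t ^ 2 = 1 → u * x t ^ 2 = u * x (g * t * g⁻¹) ^ 2 := by
  obtain ⟨w, rfl⟩ := exists_word u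
  rw [factorSubgroup_prod] at hg
  induction hg using Subgroup.closure_induction with
  -- The square is brought next to the letter `x a`, conjugated by passing it, and returned to the
  -- end; both squares are central.
  | mem a ha =>
    intro t ht
    obtain ⟨w₁, w₂, rfl⟩ := List.append_of_mem (ha : a ∈ w)
    have h1 := commute_of_alpha_eq_one (alpha_square ht)
    have h2 := commute_of_alpha_eq_one (alpha_square (conj_sq_eq_one ht a))
    simp only [List.map_append, List.map_cons, List.prod_append, List.prod_cons]
    have e : x a * x t ^ 2 = x (a * t * a⁻¹) ^ 2 * x a := by
      rw [mul_eq_rho_mul, alpha_x, map_pow, rho_x]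
    rw [mul_assoc, mul_assoc, ← (h1 _).eq, ← mul_assoc (x a), e, (h2 _).eq, mul_assoc (x a),
      (h2 _).eq, mul_assoc, mul_assoc]
    simp only [mul_assoc]
  | one => simp
  | mul a b _ _ iha ihb =>
    intro t ht
    rw [ihb t ht, iha _ (conj_sq_eq_one ht b)]
    congr 3
    group
  | inv a _ ih =>
    intro t ht
    rw [ih (a⁻¹ * t * a⁻¹⁻¹) (conj_sq_eq_one ht _)]
    congr 3
    group

/-- The product of the squares `x_t²` over a list. -/
def squares (L : List G) : FactSemigroup G := (L.map fun t => x t ^ 2).prod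

theorem squares_nil : squares ([] : List G) = 1 := rfl

theorem squares_cons (t : G) (L : List G) : squares (t :: L) = x t ^ 2 * squares L := by
  simp [squares]

theorem squares_append (L L' : List G) : squares (L ++ L') = squares L * squares L' := by
  simp [squares]

theorem factorSubgroup_squares (L : List G) :
    factorSubgroup (squares L) = Subgroup.closure {t | t ∈ L} := by
  induction L with
  | nil => simp [squares_nil, factorSubgroup_one]
  | cons t L ih =>
    rw [squares_cons, factorSubgroup_mul, pow_two, factorSubgroup_mul, factorSubgroup_x, sup_idem,
      ih, ← Subgroup.closure_union]
    congr 1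
    ext g
    simp

theorem squares_middle {t : G} (ht : t ^ 2 = 1) (L L' : List G) :
    squares (L ++ t :: L') = squares (L ++ L') * x t ^ 2 := by
  rw [squares_append, squares_cons, squares_append, mul_assoc,
    (commute_of_alpha_eq_one (alpha_square ht) _).eq]

theorem squares_middle_conj (u : FactSemigroup G) {L L' : List G} {t g : G} (ht : t ^ 2 = 1)
    (hg : g ∈ factorSubgroup (u * squares (L ++ L'))) :
    u * squares (L ++ t :: L') = u * squares (L ++ (g * t * g⁻¹) :: L') := by
  rw [squares_middle ht, squares_middle (conj_sq_eq_one ht g), ← mul_assoc, ← mul_assoc,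
    mul_square_conj _ hg t ht]

theorem ln_squares {L : List G} (hL : ∀ t ∈ L, t ≠ 1) : ln (squares L) = 2 * L.length := by
  induction L with
  | nil => simp [squares_nil, ln_one]
  | cons t L ih =>
    rw [squares_cons, ln_mul, pow_two, ln_mul, ln_x (hL t (by simp)),
      ih fun a ha => hL a (by simp [ha]), List.length_cons]
    omega

end FactSemigroup
-- Groups generated by transpositions, orbits and exchange
namespace SymFact

open FactSemigroup Equiv.Perm

variable {d : ℕ}

section Swaps

variable {S : Set (Equiv.Perm (Fin d))}

theorem swap_mem_closure_iff (hS : ∀ f ∈ S, f.IsSwap) {a b : Fin d} :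
    Equiv.swap a b ∈ Subgroup.closure S ↔ ∃ g ∈ Subgroup.closure S, g b = a := by
  rw [swap_mem_closure_isSwap hS, MulAction.mem_orbit_iff]
  constructor
  · rintro ⟨g, hg⟩
    exact ⟨g, g.2, hg⟩
  · rintro ⟨g, hg, h⟩
    exact ⟨⟨g, hg⟩, h⟩

/-- Exchange property of transpositions: if `θ` is generated by `S` and `τ` but not by `S`, then
it is conjugate to `τ` under `⟨S⟩`. -/
theorem exists_conj_of_mem_closure_insert (hS : ∀ f ∈ S, f.IsSwap) {τ θ : Equiv.Perm (Fin d)}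
    (hτ : τ.IsSwap) (hθ : θ.IsSwap) (h : θ ∈ Subgroup.closure (insert τ S))
    (hn : θ ∉ Subgroup.closure S) : ∃ g ∈ Subgroup.closure S, g * τ * g⁻¹ = θ := by
  obtain ⟨a, b, hab, rfl⟩ := hτ
  obtain ⟨p, q, hpq, rfl⟩ := hθ
  set H := Subgroup.closure S with hH
  have refl : ∀ y, Equiv.swap y y ∈ H := fun y => by rw [Equiv.swap_self]; exact one_mem H
  have symm : ∀ {y z}, Equiv.swap y z ∈ H → Equiv.swap z y ∈ H := fun h => by
    rwa [Equiv.swap_comm]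
  have trans : ∀ {y z w}, Equiv.swap y z ∈ H → Equiv.swap z w ∈ H → Equiv.swap y w ∈ H :=
    fun h h' => SubmonoidClass.swap_mem_trans H h h'
  -- `Equiv.swap y z ∈ H` expresses that `y` and `z` share an `H`-orbit. Adding the transposition
  -- `(a, b)` can only merge the orbits of `a` and `b`.
  have key : ∀ g ∈ Subgroup.closure (insert (Equiv.swap a b) S), ∀ y,
      Equiv.swap y (g y) ∈ H ∨ ((Equiv.swap y a ∈ H ∨ Equiv.swap y b ∈ H) ∧
        (Equiv.swap (g y) a ∈ H ∨ Equiv.swap (g y) b ∈ H)) := by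
    intro g hg
    induction hg using Subgroup.closure_induction with
    | mem g hg =>
      intro y
      rcases hg with rfl | hg
      · by_cases ha : y = a
        · subst ha
          right
          rw [Equiv.swap_apply_left]
          exact ⟨Or.inl (refl _), Or.inr (refl _)⟩
        by_cases hb : y = b
        · subst hb
          right
          rw [Equiv.swap_apply_right]
          exact ⟨Or.inr (refl _), Or.inl (refl _)⟩
        rw [Equiv.swap_apply_of_ne_of_ne ha hb]
        exact Or.inl (refl _)
      · exact Or.inl (symm ((swap_mem_closure_iff hS).2 ⟨g, Subgroup.subset_closure hg, rfl⟩))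
    | one => intro y; exact Or.inl (refl _)
    | mul g g' _ _ ih ih' =>
      intro y
      rw [Equiv.Perm.mul_apply]
      rcases ih' y with h1 | ⟨h1, h2⟩ <;> rcases ih (g' y) with h3 | ⟨h3, h4⟩
      · exact Or.inl (trans h1 h3)
      · exact Or.inr ⟨h3.imp (trans h1) (trans h1), h4⟩
      · exact Or.inr ⟨h1, h2.imp (trans (symm h3)) (trans (symm h3))⟩
      · exact Or.inr ⟨h1, h4⟩
    | inv g _ ih =>
      intro y
      have := ih (g⁻¹ y)
      rw [← Equiv.Perm.mul_apply, mul_inv_cancel, Equiv.Perm.one_apply] at this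
      exact this.imp symm And.symm
  have conj : ∀ {p q}, Equiv.swap p q ∉ H → Equiv.swap p a ∈ H → Equiv.swap q b ∈ H →
      ∃ g ∈ H, g * Equiv.swap a b * g⁻¹ = Equiv.swap p q := by
    intro p q hn hpa hqb
    -- This element takes `a` to `p` and `b` to `q`, since `p` and `q` lie in different orbits.
    refine ⟨Equiv.swap p a * Equiv.swap q b, mul_mem hpa hqb, ?_⟩
    have haq : a ≠ q := by rintro rfl; exact hn hpa
    have hbp : p ≠ b := by rintro rfl; exact hn (symm hqb)
    have hpq : p ≠ q := by rintro rfl; exact hn (refl _)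
    rw [← Equiv.swap_apply_apply, Equiv.Perm.mul_apply, Equiv.Perm.mul_apply,
      Equiv.swap_apply_of_ne_of_ne haq hab, Equiv.swap_apply_right, Equiv.swap_apply_right,
      Equiv.swap_apply_of_ne_of_ne hpq.symm haq.symm]
  have hk := key _ h p
  rw [Equiv.swap_apply_left] at hk
  rcases hk with h0 | ⟨h1 | h1, h2 | h2⟩
  · exact absurd h0 hn
  · exact absurd (trans h1 (symm h2)) hn
  · exact conj hn h1 h2
  · rw [Equiv.swap_comm p q] at hn ⊢
    exact conj hn h2 h1
  · exact absurd (trans h1 (symm h2)) hn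

end Swaps

/-- The number of orbits of a permutation group. -/
noncomputable def orbitCount (H : Subgroup (Equiv.Perm (Fin d))) : ℕ :=
  Nat.card (MulAction.orbitRel.Quotient H (Fin d))

theorem orbitCount_bot : orbitCount (⊥ : Subgroup (Equiv.Perm (Fin d))) = d := by
  have : Function.Bijective
      (Quotient.mk'' : Fin d → MulAction.orbitRel.Quotient
        (⊥ : Subgroup (Equiv.Perm (Fin d))) (Fin d)) := by
    refine ⟨fun a b h => ?_, Quotient.mk''_surjective⟩
    obtain ⟨⟨g, hg⟩, h⟩ := (MulAction.orbitRel_apply).1 (Quotient.eq''.1 h)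
    rw [Subgroup.mem_bot] at hg
    subst hg
    simpa using h.symm
  rw [orbitCount, ← Nat.card_eq_of_bijective _ this, Nat.card_fin]

/-- The natural map from `H`-orbits to `K`-orbits is onto but identifies the orbits of `a` and `b`.
-/
theorem orbitCount_lt {H K : Subgroup (Equiv.Perm (Fin d))} (hHK : H ≤ K) {a b : Fin d}
    (hK : a ∈ MulAction.orbit K b) (hH : a ∉ MulAction.orbit H b) :
    orbitCount K < orbitCount H := by
  classical
  let f : MulAction.orbitRel.Quotient H (Fin d) → MulAction.orbitRel.Quotient K (Fin d) :=
    Quotient.map' id (by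
      rintro a b ⟨g, h⟩
      exact ⟨⟨g, hHK g.2⟩, h⟩)
  have hf : Function.Surjective f := by
    intro y
    induction y using Quotient.inductionOn' with
    | h y => exact ⟨Quotient.mk'' y, rfl⟩
  rw [orbitCount, orbitCount]
  refine lt_of_le_of_ne (Nat.card_le_card_of_surjective f hf) fun h => hH ?_
  have hi : Function.Injective f :=
    ((Nat.bijective_iff_surjective_and_card f).2 ⟨hf, h.symm⟩).1
  have : (Quotient.mk'' a : MulAction.orbitRel.Quotient H (Fin d)) = Quotient.mk'' b :=
    hi (Quotient.sound' hK)
  exact Quotient.eq''.1 this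

theorem closure_eq_top_of_orbitCount_le_one {S : Set (Equiv.Perm (Fin d))}
    (hS : ∀ f ∈ S, f.IsSwap) (h : orbitCount (Subgroup.closure S) ≤ 1) :
    Subgroup.closure S = ⊤ := by
  have hsub : Subsingleton (MulAction.orbitRel.Quotient (Subgroup.closure S) (Fin d)) :=
    Finite.card_le_one_iff_subsingleton.1 h
  rw [eq_top_iff, ← Equiv.Perm.closure_isSwap, Subgroup.closure_le]
  rintro f ⟨a, b, -, rfl⟩
  exact (swap_mem_closure_isSwap hS).2 (Quotient.eq''.1 (Subsingleton.elim
    (Quotient.mk'' a : MulAction.orbitRel.Quotient (Subgroup.closure S) (Fin d)) (Quotient.mk'' b)))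

theorem orbitCount_append_lt {B : List (Equiv.Perm (Fin d))} (hB : ∀ f ∈ B, f.IsSwap)
    {τ : Equiv.Perm (Fin d)} (hτ : τ.IsSwap) (hn : τ ∉ Subgroup.closure {f | f ∈ B}) :
    orbitCount (Subgroup.closure {f | f ∈ B ++ [τ]}) < orbitCount (Subgroup.closure {f | f ∈ B}) := by
  obtain ⟨a, b, hab, rfl⟩ := hτ
  refine orbitCount_lt (a := a) (b := b) (Subgroup.closure_mono fun f hf => ?_) ?_ ?_
  · exact List.mem_append_left _ hf
  · exact ⟨⟨Equiv.swap a b, Subgroup.subset_closure (by simp)⟩, Equiv.swap_apply_right a b⟩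
  · rwa [← swap_mem_closure_isSwap (S := {f | f ∈ B}) hB]

/-- In a long enough list `B ++ R` of transpositions in which `B` is independent and does not
generate `θ`, some member of `R` can be replaced by `θ`: either it is generated by the preceding
ones or it is conjugate to `θ` under them. -/
theorem exists_exchange {θ : Equiv.Perm (Fin d)} (hθ : θ.IsSwap) (R : List (Equiv.Perm (Fin d))) :
    ∀ B : List (Equiv.Perm (Fin d)), (∀ f ∈ B, f.IsSwap) → (∀ f ∈ R, f.IsSwap) →
      θ ∉ Subgroup.closure {f | f ∈ B} →
      orbitCount (Subgroup.closure {f | f ∈ B}) + B.length ≤ d → d ≤ B.length + R.length + 1 →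
      ∃ R₁ τ R₂, R = R₁ ++ τ :: R₂ ∧ (τ ∈ Subgroup.closure {f | f ∈ B ++ R₁} ∨
        ∃ g ∈ Subgroup.closure {f | f ∈ B ++ R₁}, g * τ * g⁻¹ = θ) := by
  induction R with
  | nil =>
    intro B hB _ hn hc hl
    -- Now `B` has at least `d - 1` members, so at most one orbit is left and `B` generates
    -- everything, `θ` included.
    rw [closure_eq_top_of_orbitCount_le_one (S := {f | f ∈ B}) hB (by simp at hl; omega)] at hn
    simp at hn
  | cons τ R ih =>
    intro B hB hR hn hc hl
    have hτ : τ.IsSwap := hR τ (by simp)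
    by_cases h1 : τ ∈ Subgroup.closure {f | f ∈ B}
    · exact ⟨[], τ, R, rfl, Or.inl (by simpa using h1)⟩
    by_cases h2 : θ ∈ Subgroup.closure {f | f ∈ B ++ [τ]}
    · have e : {f | f ∈ B ++ [τ]} = insert τ {f | f ∈ B} := by ext; simp [or_comm]
      rw [e] at h2
      exact ⟨[], τ, R, rfl, Or.inr
        (by simpa using exists_conj_of_mem_closure_insert (S := {f | f ∈ B}) hB hτ hθ h2 hn)⟩
    -- Otherwise `τ` is independent of `B` and still does not help to generate `θ`, so it joins `B`.
    obtain ⟨R₁, τ', R₂, rfl, h⟩ := ih (B ++ [τ])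
      (by simpa [or_imp, forall_and] using ⟨hB, hτ⟩) (fun f hf => hR f (by simp [hf])) h2
      (by have := orbitCount_append_lt hB hτ h1; rw [List.length_append, List.length_singleton]; omega) (by simp at hl ⊢; omega)
    exact ⟨τ :: R₁, τ', R₂, rfl, by simpa using h⟩

end SymFact
-- Products of transpositions as regenerated permutations times squares
namespace SymFact

open FactSemigroup Equiv.Perm

variable {d : ℕ}

theorem swap_sq_eq_one {t : Equiv.Perm (Fin d)} (ht : t.IsSwap) : t ^ 2 = 1 := by
  obtain ⟨a, b, -, rfl⟩ := ht
  rw [pow_two, Equiv.swap_mul_self]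

theorem swap_ne_one {t : Equiv.Perm (Fin d)} (ht : t.IsSwap) : t ≠ 1 := by
  obtain ⟨a, b, hab, rfl⟩ := ht
  rwa [Ne, Equiv.swap_eq_one_iff]

/-- A list `a :: l₁ ++ b :: l₂` splits off the transposition `(a, b)`. -/
theorem pathWord_join (a b : Fin d) (l₁ l₂ : List (Fin d)) (h : (a :: l₁ ++ b :: l₂).Nodup) :
    pathWord (a :: l₁ ++ b :: l₂)
      = x (Equiv.swap a b) * pathWord (a :: l₁) * pathWord (b :: l₂) := by
  have insert_mid : ∀ (u : List (Fin d)) (c : Fin d),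
      pathWord (u ++ c :: b :: l₂)
        = pathWord (u ++ [c]) * x (Equiv.swap c b) * pathWord (b :: l₂) := by
    intro u c
    induction u with
    | nil => rw [List.nil_append, List.nil_append, pathWord_cons_cons]; simp [pathWord]
    | cons e u ih =>
      cases u with
      | nil =>
        simp only [List.cons_append, List.nil_append] at ih ⊢
        rw [pathWord_cons_cons, ih, pathWord_cons_cons]
        simp only [mul_assoc]
      | cons f u =>
        simp only [List.cons_append] at ih ⊢
        rw [pathWord_cons_cons, ih, pathWord_cons_cons]
        simp only [mul_assoc]
  obtain ⟨u, c, huc⟩ : ∃ u c, a :: l₁ = u ++ [c] :=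
    ⟨(a :: l₁).dropLast, (a :: l₁).getLast (by simp), (List.dropLast_append_getLast _).symm⟩
  have e : pathWord (a :: l₁ ++ b :: l₂)
      = pathWord (a :: l₁) * x (Equiv.swap c b) * pathWord (b :: l₂) := by
    rw [huc, List.append_assoc, List.singleton_append, insert_mid]
  have hb : b ∉ a :: l₁ := fun hb => (List.disjoint_of_nodup_append h) hb (by simp)
  have hc : c = (a :: l₁).getLast (by simp) := by simp [huc]
  have h1 : (a :: l₁).formPerm c = a := by rw [hc]; exact List.formPerm_apply_getLast a l₁
  have h2 : (a :: l₁).formPerm b = b := List.formPerm_apply_of_notMem hb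
  -- The link `(c, b)` between the two paths moves left past the first one, whose cycle sends `c` to
  -- `a` and fixes `b`.
  rw [e, mul_eq_rho_mul (pathWord (a :: l₁)), rho_x, alpha_pathWord, ← Equiv.swap_apply_apply,
    h1, h2]

theorem regenElt_one : regenElt (1 : Equiv.Perm (Fin d)) = 1 := by
  have h := congrArg Subtype.val (map_one (regen d))
  rw [← x_one] at h
  exact h

theorem regenElt_mul {σ τ : Equiv.Perm (Fin d)} (h : σ.Disjoint τ) :
    regenElt (σ * τ) = regenElt σ * regenElt τ := by
  unfold regenElt
  exact (Finset.noncommProd_congr h.cycleFactorsFinset_mul_eq_union (fun _ _ => rfl) _).trans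
    (Finset.noncommProd_union_of_disjoint h.disjoint_cycleFactorsFinset _ _)

theorem regenElt_of_isCycle {c : Equiv.Perm (Fin d)} (hc : c.IsCycle) :
    regenElt c = cycleElt c := by
  unfold regenElt
  rw [Finset.noncommProd_congr (cycleFactorsFinset_eq_singleton_iff.2 ⟨hc, rfl⟩)
    (fun _ _ => rfl), Finset.noncommProd_singleton]

theorem regenElt_formPerm {l : List (Fin d)} (hl : l.Nodup) :
    regenElt l.formPerm = pathWord l := by
  match l, hl with
  | [], _ => simp [regenElt_one, pathWord]
  | [a], _ => simp [regenElt_one, pathWord]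
  | a :: b :: l, hl =>
    have hc : (a :: b :: l).formPerm.IsCycle := List.isCycle_formPerm hl (by simp)
    have ha : a ∈ (a :: b :: l).formPerm.support := by
      rw [List.support_formPerm_of_nodup _ hl (by simp)]
      simp
    rw [regenElt_of_isCycle hc, cycleElt_eq hc ha]
    congr 1
    exact toList_formPerm_nontrivial (a :: b :: l) (by simp) hl

/-- The cycle of `σ` through `a`, written as a list starting at `a`. -/
theorem exists_cycle_list (σ : Equiv.Perm (Fin d)) (a : Fin d) :
    ∃ (l : List (Fin d)) (ρ : Equiv.Perm (Fin d)), (a :: l).Nodup ∧ σ = (a :: l).formPerm * ρ ∧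
      (∀ y ∈ a :: l, ρ y = y) ∧ ∀ y ∈ l, σ y ≠ y := by
  by_cases ha : a ∈ σ.support
  · obtain ⟨b, l, hl⟩ : ∃ b l, σ.toList a = b :: l := by
      rcases h : σ.toList a with _ | ⟨b, l⟩
      · exact absurd ha (toList_eq_nil_iff.1 h)
      · exact ⟨b, l, rfl⟩
    have hb : b = a := by
      have h0 := Equiv.Perm.getElem_toList σ a 0 (by rw [hl]; simp)
      simpa [hl] using h0
    subst hb
    have hd := disjoint_mul_inv_of_mem_cycleFactorsFinset
      (cycleOf_mem_cycleFactorsFinset_iff.2 ha)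
    have hf : (b :: l).formPerm = σ.cycleOf b := by rw [← hl, formPerm_toList]
    have hmem : ∀ y ∈ b :: l, σ.SameCycle b y := fun y hy => by
      rw [← hl] at hy
      exact (mem_toList_iff.1 hy).1
    have hmv : ∀ y ∈ b :: l, σ y ≠ y := fun y hy => by
      have := (hmem y hy).apply_eq_self_iff
      rw [Equiv.Perm.mem_support] at ha
      tauto
    refine ⟨l, σ * (σ.cycleOf b)⁻¹, hl ▸ nodup_toList _ _, ?_, fun y hy => ?_,
      fun y hy => hmv y (by simp [hy])⟩
    · rw [hf, ← hd.commute.eq, inv_mul_cancel_right]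
    · refine (hd y).resolve_right fun h => ?_
      rw [(hmem y hy).cycleOf_apply] at h
      exact hmv y hy h
  · exact ⟨[], σ, by simp, by simp, by simpa using ha, by simp⟩

theorem regenElt_formPerm_mul {l : List (Fin d)} (hl : l.Nodup) {ρ : Equiv.Perm (Fin d)}
    (hρ : ∀ y ∈ l, ρ y = y) : regenElt (l.formPerm * ρ) = pathWord l * regenElt ρ := by
  rw [regenElt_mul, regenElt_formPerm hl]
  intro y
  by_cases hy : y ∈ l
  · exact Or.inr (hρ y hy)
  · exact Or.inl (List.formPerm_apply_of_notMem hy)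

/-- Multiplying by a transposition changes a regenerated permutation at most by a square. -/
theorem x_mul_regenElt {t : Equiv.Perm (Fin d)} (ht : t.IsSwap) (σ : Equiv.Perm (Fin d)) :
    x t * regenElt σ = regenElt (t * σ) ∨ x t * regenElt σ = x t ^ 2 * regenElt (t * σ) := by
  have key : ∀ (a b : Fin d) (l₁ l₂ : List (Fin d)) (ρ : Equiv.Perm (Fin d)),
      (a :: l₁ ++ b :: l₂).Nodup → (∀ y ∈ a :: l₁ ++ b :: l₂, ρ y = y) →
      x (Equiv.swap a b) * regenElt ((a :: l₁).formPerm * ((b :: l₂).formPerm * ρ))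
        = regenElt ((a :: l₁ ++ b :: l₂).formPerm * ρ) := by
    intro a b l₁ l₂ ρ hn hρ
    have hdis := List.disjoint_of_nodup_append hn
    rw [regenElt_formPerm_mul hn hρ, regenElt_formPerm_mul hn.of_append_left,
      regenElt_formPerm_mul hn.of_append_right, pathWord_join a b l₁ l₂ hn]
    · simp only [mul_assoc]
    · exact fun y hy => hρ y (List.mem_append_right _ hy)
    · intro y hy
      rw [Equiv.Perm.mul_apply, hρ y (List.mem_append_left _ hy),
        List.formPerm_apply_of_notMem fun h => hdis hy h]
  have alph : ∀ {u v : Equiv.Perm (Fin d)}, x t * regenElt u = regenElt v → t * u = v := by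
    intro u v h
    have := congrArg alpha h
    rwa [map_mul, alpha_x, alpha_regenElt, alpha_regenElt] at this
  obtain ⟨a, b, hab, rfl⟩ := ht
  obtain ⟨l, ρ, hl, rfl, hρ, hmv⟩ := exists_cycle_list σ a
  by_cases hb : b ∈ l
  -- Here `a` and `b` lie on one cycle: `t` cuts it, `regenElt σ = x t * regenElt (t * σ)`, and a
  -- square appears.
  · obtain ⟨l₁, l₂, rfl⟩ := List.append_of_mem hb
    have h := key a b l₁ l₂ ρ hl hρ
    right
    have h' := congrArg (Equiv.swap a b * ·) (alph h)
    simp only [← mul_assoc, Equiv.swap_mul_self, one_mul] at h'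
    rw [List.cons_append] at h h'
    rw [← mul_assoc, ← h', pow_two, mul_assoc (x _), mul_assoc (List.formPerm (a :: l₁)), h]
  -- Here `a` and `b` lie on different cycles, possibly trivial, which `t` joins.
  · obtain ⟨l', ρ', hl', rfl, hρ', hmv'⟩ := exists_cycle_list ρ b
    left
    have hdis : List.Disjoint (a :: l) (b :: l') := by
      intro y hy hy'
      rcases List.mem_cons.1 hy' with rfl | hy'
      · rcases List.mem_cons.1 hy with rfl | hy
        · exact hab rfl
        · exact hb hy
      · exact hmv' y hy' (hρ y hy)
    have h := key a b l l' ρ' (hl.append hl' hdis) (fun y hy => by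
      rcases List.mem_append.1 hy with hy | hy
      · have := hρ y hy
        rwa [Equiv.Perm.mul_apply, ← Equiv.Perm.eq_inv_iff_eq, ← List.formPerm_reverse,
          List.formPerm_apply_of_notMem] at this
        rw [List.mem_reverse]
        exact fun h => hdis hy h
      · exact hρ' y hy)
    rw [h, alph h]

theorem exists_squares {T : SymFact d} (hT : T ∈ transp d) :
    ∃ L : List (Equiv.Perm (Fin d)), (∀ t ∈ L, t.IsSwap) ∧ T = regenElt (alpha T) * squares L := by
  induction hT using Submonoid.closure_induction_left with
  | one => exact ⟨[], by simp, by simp [regenElt_one, squares_nil]⟩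
  | mul_left u hu T _ ih =>
    obtain ⟨t, ht, rfl⟩ := hu
    obtain ⟨L, hL, hT⟩ := ih
    rw [map_mul, alpha_x]
    rcases x_mul_regenElt ht (alpha T) with h | h
    · refine ⟨L, hL, ?_⟩
      rw [← h, mul_assoc, ← hT]
    · refine ⟨t :: L, by simpa [ht] using hL, ?_⟩
      rw [squares_cons, ← mul_assoc, ← (commute_of_alpha_eq_one
        (alpha_square (swap_sq_eq_one ht)) _).eq, ← h, mul_assoc, ← hT]

theorem ln_pathWord {l : List (Fin d)} (hl : l.Nodup) : ln (pathWord l) = l.length - 1 := by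
  induction l with
  | nil => simp [pathWord, ln_one]
  | cons a l ih =>
    cases l with
    | nil => simp [pathWord, ln_one]
    | cons b l =>
      rw [pathWord_cons_cons, ln_mul, ln_x, ih hl.of_cons]
      · simp [add_comm]
      · rw [Ne, Equiv.swap_eq_one_iff]
        rintro rfl
        simp at hl

theorem ln_regenElt (σ : Equiv.Perm (Fin d)) :
    ln (regenElt σ) + Multiset.card σ.cycleType = σ.support.card := by
  induction σ using cycle_induction_on with
  | base_one => simp [regenElt_one, ln_one]
  | base_cycles c hc =>
    obtain ⟨a, ha⟩ := hc.nonempty_support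
    have := hc.two_le_card_support
    rw [regenElt_of_isCycle hc, cycleElt_eq hc ha, ln_pathWord (nodup_toList _ _), length_toList,
      hc.cycleOf_eq (Equiv.Perm.mem_support.1 ha), hc.cycleType, Multiset.card_singleton]
    omega
  | induction_disjoint σ τ h _ ih1 ih2 =>
    rw [regenElt_mul h, ln_mul, h.cycleType_mul, Multiset.card_add, h.card_support_mul]
    omega

/-- The length is the size of the support minus the number of nontrivial cycles, and `σ ≠ 1` has at
least one such cycle. -/
theorem ln_regenElt_lt (hd : 1 ≤ d) (σ : Equiv.Perm (Fin d)) : ln (regenElt σ) + 1 ≤ d := by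
  have h := ln_regenElt σ
  have hc : σ.support.card ≤ d := by simpa using σ.support.card_le_univ
  by_cases h0 : σ = 1
  · subst h0
    rw [regenElt_one, ln_one]
    omega
  · have := Equiv.Perm.card_cycleType_pos.2 h0
    omega

end SymFact
-- Adjacent transpositions and the Hurwitz element
namespace SymFact

open FactSemigroup Equiv.Perm

variable {d : ℕ}

theorem isSwap_conj {t : Equiv.Perm (Fin d)} (ht : t.IsSwap) (g : Equiv.Perm (Fin d)) :
    (g * t * g⁻¹).IsSwap := by
  obtain ⟨a, b, hab, rfl⟩ := ht
  rw [← Equiv.swap_apply_apply]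
  exact ⟨_, _, fun h => hab (g.injective h), rfl⟩

/-- The transposition of `i` and `i + 1`. -/
def adjSwap (d i : ℕ) : Equiv.Perm (Fin d) :=
  if h : i + 1 < d then Equiv.swap ⟨i, by omega⟩ ⟨i + 1, h⟩ else 1

theorem adjSwap_isSwap {i : ℕ} (h : i + 1 < d) : (adjSwap d i).IsSwap := by
  rw [adjSwap, dif_pos h]
  exact ⟨_, _, by simp, rfl⟩

/-- The list of the first `j` adjacent transpositions. -/
def adjSwaps (d j : ℕ) : List (Equiv.Perm (Fin d)) := (List.range j).map (adjSwap d)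

theorem adjSwaps_succ (j : ℕ) : adjSwaps d (j + 1) = adjSwaps d j ++ [adjSwap d j] := by
  simp [adjSwaps, List.range_succ]

theorem length_adjSwaps (j : ℕ) : (adjSwaps d j).length = j := by simp [adjSwaps]

theorem isSwap_of_mem_adjSwaps {j : ℕ} (hj : j + 1 ≤ d) :
    ∀ f ∈ adjSwaps d j, f.IsSwap := by
  intro f hf
  obtain ⟨i, hi, rfl⟩ := List.mem_map.1 hf
  exact adjSwap_isSwap (by rw [List.mem_range] at hi; omega)

/-- The earlier adjacent transpositions all fix the point `j + 1`, which `adjSwap d j` moves. -/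
theorem adjSwap_notMem_closure {j : ℕ} (hj : j + 1 < d) :
    adjSwap d j ∉ Subgroup.closure {f | f ∈ adjSwaps d j} := by
  have hfix : Subgroup.closure {f | f ∈ adjSwaps d j}
      ≤ MulAction.stabilizer (Equiv.Perm (Fin d)) (⟨j + 1, hj⟩ : Fin d) := by
    rw [Subgroup.closure_le]
    intro f hf
    obtain ⟨i, hi, rfl⟩ := List.mem_map.1 hf
    rw [List.mem_range] at hi
    have hi' : i + 1 < d := by omega
    change adjSwap d i ⟨j + 1, hj⟩ = ⟨j + 1, hj⟩
    rw [adjSwap, dif_pos hi']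
    exact Equiv.swap_apply_of_ne_of_ne (by simp; omega) (by simp; omega)
  intro h
  have h' : adjSwap d j ⟨j + 1, hj⟩ = ⟨j + 1, hj⟩ := hfix h
  rw [adjSwap, dif_pos hj, Equiv.swap_apply_right] at h'
  simp at h'

theorem orbitCount_adjSwaps {j : ℕ} (hj : j + 1 ≤ d) :
    orbitCount (Subgroup.closure {f | f ∈ adjSwaps d j}) + j ≤ d := by
  induction j with
  | zero => simp [adjSwaps, orbitCount_bot]
  | succ j ih =>
    have := orbitCount_append_lt (isSwap_of_mem_adjSwaps (by omega)) (adjSwap_isSwap (by omega))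
      (adjSwap_notMem_closure (d := d) (j := j) (by omega))
    have := ih (by omega)
    rw [adjSwaps_succ]
    omega

theorem closure_adjSwaps (hd : 1 ≤ d) : Subgroup.closure {f | f ∈ adjSwaps d (d - 1)} = ⊤ :=
  closure_eq_top_of_orbitCount_le_one (S := {f | f ∈ adjSwaps d (d - 1)})
    (isSwap_of_mem_adjSwaps (by omega))
    (by have := orbitCount_adjSwaps (d := d) (j := d - 1) (by omega); omega)

theorem exists_conj_swap {t u : Equiv.Perm (Fin d)} (ht : t.IsSwap) (hu : u.IsSwap) :
    ∃ g, g * t * g⁻¹ = u := by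
  obtain ⟨a, b, hab, rfl⟩ := ht
  obtain ⟨p, q, hpq, rfl⟩ := hu
  exact isConj_iff.1 (isConj_swap hab hpq)

/-- Each step of the induction applies the exchange with `B` the adjacent transpositions already
obtained and `θ` the next one. -/
theorem exists_squares_adjSwaps (Y : SymFact d) {L : List (Equiv.Perm (Fin d))}
    (hL : ∀ t ∈ L, t.IsSwap) (hfull : factorSubgroup (Y * squares L) = ⊤)
    (hlen : d ≤ L.length + 1) (j : ℕ) (hj : j + 1 ≤ d) :
    ∃ R : List (Equiv.Perm (Fin d)), (∀ t ∈ R, t.IsSwap) ∧ j + R.length = L.length ∧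
      Y * squares L = Y * squares (adjSwaps d j ++ R) := by
  induction j with
  | zero => exact ⟨L, hL, by simp, by simp [adjSwaps]⟩
  | succ j ih =>
    obtain ⟨R, hR, hl, e⟩ := ih (by omega)
    have hθ : (adjSwap d j).IsSwap := adjSwap_isSwap (by omega)
    have hA : ∀ t ∈ adjSwaps d j, t.IsSwap := isSwap_of_mem_adjSwaps (by omega)
    obtain ⟨R₁, τ, R₂, rfl, h⟩ := exists_exchange hθ R (adjSwaps d j) hA hR
      (adjSwap_notMem_closure (by omega))
      (by rw [length_adjSwaps]; exact orbitCount_adjSwaps (by omega))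
      (by rw [length_adjSwaps]; omega)
    have hτ : τ.IsSwap := hR τ (by simp)
    have hmono : Subgroup.closure {f | f ∈ adjSwaps d j ++ R₁}
        ≤ factorSubgroup (Y * squares ((adjSwaps d j ++ R₁) ++ R₂)) := by
      rw [factorSubgroup_mul, factorSubgroup_squares]
      exact le_sup_of_le_right (Subgroup.closure_mono fun f hf => List.mem_append_left R₂ hf)
    have hconj : ∃ g ∈ factorSubgroup (Y * squares ((adjSwaps d j ++ R₁) ++ R₂)),
        g * τ * g⁻¹ = adjSwap d j := by
      rcases h with h | ⟨g, hg, h⟩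
      -- A redundant `τ` can be omitted without shrinking the generated group, so its square may
      -- become the square of any transposition.
      · have htop : factorSubgroup (Y * squares ((adjSwaps d j ++ R₁) ++ R₂)) = ⊤ := by
          rw [e, ← List.append_assoc, squares_middle (swap_sq_eq_one hτ), ← mul_assoc,
            factorSubgroup_mul _ (x τ ^ 2), pow_two, factorSubgroup_mul (x τ), factorSubgroup_x,
            sup_idem, sup_eq_left.2] at hfull
          · exact hfull
          · rw [Subgroup.closure_le, Set.singleton_subset_iff]
            exact hmono h
        obtain ⟨g, hg⟩ := exists_conj_swap hτ hθ
        exact ⟨g, htop ▸ Subgroup.mem_top g, hg⟩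
      · exact ⟨g, hmono hg, h⟩
    obtain ⟨g, hg, hgτ⟩ := hconj
    refine ⟨R₁ ++ R₂, fun t ht => hR t ?_, by simp at hl ⊢; omega, ?_⟩
    · simp only [List.mem_append, List.mem_cons] at ht ⊢
      tauto
    · rw [e, ← List.append_assoc, squares_middle_conj Y (swap_sq_eq_one hτ) hg, hgτ,
        squares_middle (swap_sq_eq_one hθ), adjSwaps_succ, List.append_assoc _ [_],
        List.singleton_append, squares_middle (swap_sq_eq_one hθ), List.append_assoc]

theorem mul_squares_eq_pow (Y : SymFact d) {θ : Equiv.Perm (Fin d)} (hθ : θ.IsSwap)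
    (hfull : factorSubgroup Y = ⊤) {R : List (Equiv.Perm (Fin d))} (hR : ∀ t ∈ R, t.IsSwap) :
    Y * squares R = Y * (x θ ^ 2) ^ R.length := by
  induction R generalizing Y with
  | nil => simp [squares_nil]
  | cons t R ih =>
    obtain ⟨g, rfl⟩ := exists_conj_swap (hR t (by simp)) hθ
    rw [squares_cons, ← mul_assoc, mul_square_conj Y (g := g) (hfull ▸ Subgroup.mem_top g) t
      (swap_sq_eq_one (hR t (by simp))), ih, List.length_cons, pow_succ' _ R.length,
      mul_assoc]
    · rw [factorSubgroup_mul, hfull, top_sup_eq]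
    · exact fun u hu => hR u (by simp [hu])

theorem hurwitz_eq (hd : 2 ≤ d) (g : ℕ) :
    hurwitz d g = squares (adjSwaps d (d - 1)) * (x (adjSwap d 0) ^ 2) ^ g := by
  obtain ⟨n, rfl⟩ : ∃ n, d = n + 2 := ⟨d - 2, by omega⟩
  have hc := (commute_of_alpha_eq_one (alpha_square
    (swap_sq_eq_one (adjSwap_isSwap (d := n + 2) (i := 0) (by omega))))
      (((List.range n).map fun i => x (adjSwap (n + 2) (i + 1)) ^ 2).prod)).pow_left g
  have e : hurwitz (n + 2) g = (x (adjSwap (n + 2) 0) ^ 2) ^ (g + 1) *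
      ((List.range n).map fun i => x (adjSwap (n + 2) (i + 1)) ^ 2).prod := by
    rw [hurwitz]
    change (List.ofFn (n := n + 1) _).prod = _
    rw [List.ofFn_succ, List.prod_cons]
    congr 1
    congr 1
    apply List.ext_getElem
    · simp
    · intro i h1 h2
      simp at h1
      simp [adjSwap, h1]
  rw [e, pow_succ', mul_assoc, hc.eq, ← mul_assoc]
  congr 1
  rw [squares, adjSwaps, List.map_map]
  change _ = (List.map _ (List.range (n + 1))).prod
  rw [List.range_succ_eq_map, List.map_cons, List.prod_cons, List.map_map]
  rfl

theorem squares_mem_transp {L : List (Equiv.Perm (Fin d))} (hL : ∀ t ∈ L, t.IsSwap) :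
    squares L ∈ transp d := by
  refine Submonoid.list_prod_mem _ fun u hu => ?_
  obtain ⟨t, ht, rfl⟩ := List.mem_map.1 hu
  have h : x t ∈ transp d := Submonoid.subset_closure ⟨t, hL t ht, rfl⟩
  exact pow_mem h 2

/-- The normal form of the part consisting of transpositions. -/
theorem exists_normal_form (hd : 1 ≤ d) (Y : SymFact d) {T : SymFact d} (hT : T ∈ transp d)
    (hk : 3 * d ≤ ln T + 3) (hfull : factorSubgroup (Y * T) = ⊤) :
    ∃ R : List (Equiv.Perm (Fin d)), (∀ t ∈ R, t.IsSwap) ∧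
      Y * T = Y * (regenElt (alpha T) * squares (adjSwaps d (d - 1) ++ R)) ∧
      ln T = ln (regenElt (alpha T)) + 2 * (d - 1 + R.length) := by
  obtain ⟨L, hL, e⟩ := exists_squares hT
  have hlen : ln T = ln (regenElt (alpha T)) + 2 * L.length := by
    conv_lhs => rw [e]
    rw [ln_mul, ln_squares fun t ht => swap_ne_one (hL t ht)]
  have hlt := ln_regenElt_lt hd (alpha T)
  have e' : Y * T = Y * regenElt (alpha T) * squares L := by rw [mul_assoc, ← e]
  obtain ⟨R, hR, hl, e2⟩ := exists_squares_adjSwaps (Y * regenElt (alpha T)) hL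
    -- From `3 (d - 1) ≤ ln T` and a regenerated part of length at most `d - 1` it follows that
    -- `L.length ≥ d - 1`.
    (by rw [← e', hfull]) (by omega) (d - 1) (by omega)
  exact ⟨R, hR, by rw [e', e2, mul_assoc], by omega⟩

theorem exists_hurwitz_form (hd : 1 ≤ d) (Y : SymFact d) {T : SymFact d} (hT : T ∈ transp d)
    (hk : 3 * d ≤ ln T + 3) (hfull : factorSubgroup (Y * T) = ⊤) :
    ∃ g : ℕ, Y * T = Y * regenElt (alpha T) * hurwitz d g ∧
      ln T = ln (regenElt (alpha T)) + 2 * (d - 1 + g) := by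
  obtain ⟨R, hR, e, hl⟩ := exists_normal_form hd Y hT hk hfull
  refine ⟨R.length, ?_, hl⟩
  rcases Nat.lt_or_ge d 2 with h | h
  · obtain rfl : d = 1 := by omega
    have : R = [] := by
      rcases R with _ | ⟨t, R⟩
      · rfl
      · exact absurd (Subsingleton.elim t 1) (swap_ne_one (hR t (by simp)))
    subst this
    rw [e]
    simp [adjSwaps, squares_nil, hurwitz]
  · rw [e, squares_append, ← mul_assoc, ← mul_assoc, hurwitz_eq h, ← mul_assoc]
    refine mul_squares_eq_pow _ (adjSwap_isSwap (by omega)) ?_ hR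
    rw [factorSubgroup_mul, factorSubgroup_squares, closure_adjSwaps hd, sup_top_eq]

/-! ### Conjugating the factors that are not transpositions -/

/-- One of the first factors may be replaced by a conjugate, at the expense of the factors that
are transpositions. -/
theorem exists_conj_factor (hd : 1 ≤ d) {k : ℕ} (hk : 3 * d ≤ k + 3)
    (g : Equiv.Perm (Fin d)) : ∀ (A : SymFact d) (σ : Equiv.Perm (Fin d)) (B T : SymFact d),
      T ∈ transp d → ln T = k → factorSubgroup (A * x σ * B * T) = ⊤ →
      ∃ T' ∈ transp d, ln T' = k ∧ A * x σ * B * T = A * x (g * σ * g⁻¹) * B * T' := by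
  -- Adjacent transpositions generate the group even as a monoid, so one conjugation by such a `τ`
  -- is the only real case.
  have hg : g ∈ Submonoid.closure {f | f ∈ adjSwaps d (d - 1)} := by
    obtain ⟨n, rfl⟩ : ∃ n, d = n + 1 := ⟨d - 1, by omega⟩
    have h := mclosure_swap_castSucc_succ n
    refine Submonoid.closure_mono ?_ (h ▸ Submonoid.mem_top g)
    rintro f ⟨i, rfl⟩
    refine List.mem_map.2 ⟨i.val, by simp, ?_⟩
    rw [adjSwap, dif_pos (by omega)]
    rfl
  induction hg using Submonoid.closure_induction with
  | mem τ hτ =>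
    intro A σ B T hT hTk hfull
    obtain ⟨P₁, P₂, hP⟩ := List.append_of_mem (show τ ∈ adjSwaps d (d - 1) from hτ)
    have hsw := isSwap_of_mem_adjSwaps (d := d) (j := d - 1) (by omega)
    have hτs : τ.IsSwap := hsw τ hτ
    obtain ⟨R, hR, e, hl⟩ := exists_normal_form hd _ hT (by omega) hfull
    have hlP := length_adjSwaps (d := d) (d - 1)
    rw [hP] at e hsw hlP
    set T₁ := regenElt (alpha T) * squares (P₁ ++ (P₂ ++ R)) with hT₁
    have hL : ∀ t ∈ P₁ ++ (P₂ ++ R), t.IsSwap := by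
      intro t ht
      simp only [List.mem_append] at ht
      rcases ht with h | h | h
      · exact hsw t (by simp [h])
      · exact hsw t (by simp [h])
      · exact hR t h
    have hc := commute_of_alpha_eq_one (alpha_square (swap_sq_eq_one hτs))
    have hgen : ∀ t : Equiv.Perm (Fin d), t.IsSwap → x t ∈ transp d :=
      fun t ht => Submonoid.subset_closure ⟨t, ht, rfl⟩
    have e1 : A * x σ * B * T = A * (x σ * (x τ * x τ)) * B * T₁ := by
      rw [e, List.append_assoc, List.cons_append, squares_middle (swap_sq_eq_one hτs),
        ← mul_assoc (regenElt _), ← hT₁, ← (hc T₁).eq, ← mul_assoc, mul_assoc (A * x σ),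
        ← (hc B).eq, ← pow_two]
      simp only [mul_assoc]
    have e2 : τ⁻¹ * σ * τ = τ * σ * τ⁻¹ := by
      have : τ⁻¹ = τ := by
        rw [inv_eq_iff_mul_eq_one, ← pow_two]
        exact swap_sq_eq_one hτs
      rw [this]
    set σ' := τ * σ * τ⁻¹ with hσ'
    -- One `x τ` moves left past `x σ`, conjugating `σ`, and then back right past `x σ'`, being
    -- conjugated itself.
    have e3 : x σ * (x τ * x τ) = x σ' * (x (σ'⁻¹ * τ * σ') * x τ) := by
      rw [← mul_assoc, x_mul_x_left σ τ, e2, x_mul_x_left τ σ', mul_assoc]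
    -- The two freed transpositions, conjugated by passing `B`, replace the square that was taken
    -- out, so the length stays `k`.
    refine ⟨rho (alpha B)⁻¹ (x (σ'⁻¹ * τ * σ') * x τ) * T₁, ?_, ?_, ?_⟩
    · rw [map_mul, rho_x, rho_x]
      refine mul_mem (mul_mem (hgen _ (isSwap_conj ?_ _)) (hgen _ (isSwap_conj hτs _)))
        (mul_mem (regenElt_mem _) (squares_mem_transp hL))
      simpa using isSwap_conj hτs σ'⁻¹
    · rw [map_mul, rho_x, rho_x, ln_mul, ln_mul, ln_x, ln_x, hT₁, ln_mul,
        ln_squares fun t ht => swap_ne_one (hL t ht)]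
      · simp only [List.length_append, List.length_cons] at hlP ⊢
        omega
      · exact swap_ne_one (isSwap_conj hτs _)
      · refine swap_ne_one (isSwap_conj ?_ _)
        simpa using isSwap_conj hτs σ'⁻¹
    · rw [e1, e3]
      simp only [mul_assoc]
      rw [← mul_assoc (x (σ'⁻¹ * (τ * σ'))), ← mul_assoc _ B, mul_eq_mul_rho _ B]
      simp only [mul_assoc]
  | one =>
    intro A σ B T hT hTk _
    exact ⟨T, hT, hTk, by simp⟩
  | mul g g' _ _ ih ih' =>
    intro A σ B T hT hTk hfull
    obtain ⟨T₁, h1, h1k, e1⟩ := ih' A σ B T hT hTk hfull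
    obtain ⟨T₂, h2, h2k, e2⟩ := ih A _ B T₁ h1 h1k (e1 ▸ hfull)
    refine ⟨T₂, h2, h2k, ?_⟩
    rw [e1, e2, show g * (g' * σ * g'⁻¹) * g⁻¹ = g * g' * σ * (g * g')⁻¹ by group]

/-! ### Canonical representatives and the conclusion -/

theorem length_filter_finRange {o k : ℕ} (h : o + k ≤ d) :
    ((List.finRange d).filter (fun i => decide (o ≤ i.val ∧ i.val < o + k))).length = k := by
  rw [← List.toFinset_card_of_nodup ((List.nodup_finRange d).filter _)]
  have e : ((List.finRange d).filter
      (fun i => decide (o ≤ i.val ∧ i.val < o + k))).toFinset.map Fin.valEmbedding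
        = Finset.Ico o (o + k) := by
    ext i
    simp only [Finset.mem_map, List.mem_toFinset, List.mem_filter, List.mem_finRange, true_and,
      decide_eq_true_eq, Fin.valEmbedding_apply, Finset.mem_Ico]
    constructor
    · rintro ⟨j, hj, rfl⟩
      exact hj
    · intro hi
      exact ⟨⟨i, by omega⟩, hi, rfl⟩
  rw [← Finset.card_map Fin.valEmbedding, e, Nat.card_Ico]
  omega

theorem blockPerm_apply_of_lt (ks : List ℕ) (o : ℕ) (i : Fin d) (hi : i.val < o) :
    blockPerm d o ks i = i := by
  induction ks generalizing o with
  | nil => rfl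
  | cons k ks ih =>
    rw [blockPerm, Equiv.Perm.mul_apply, ih _ (by omega)]
    refine List.formPerm_apply_of_notMem ?_
    simp
    omega

theorem cycleType_blockPerm (ks : List ℕ) (o : ℕ) (h2 : ∀ k ∈ ks, 2 ≤ k) (h : o + ks.sum ≤ d) :
    (blockPerm d o ks).cycleType = (ks : Multiset ℕ) := by
  induction ks generalizing o with
  | nil => simp [blockPerm]
  | cons k ks ih =>
    have hk := h2 k (by simp)
    rw [List.sum_cons] at h
    have hlen := length_filter_finRange (d := d) (o := o) (k := k) (by omega)
    have hnd : ((List.finRange d).filter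
      (fun i => decide (o ≤ i.val ∧ i.val < o + k))).Nodup := (List.nodup_finRange d).filter _
    rw [blockPerm, Disjoint.cycleType_mul, ih _ (fun k hk => h2 k (by simp [hk])) (by omega),
      (List.isCycle_formPerm hnd (by omega)).cycleType, List.support_formPerm_of_nodup _ hnd,
      List.toFinset_card_of_nodup hnd, hlen]
    · rfl
    · intro a ha
      rw [ha, List.length_singleton] at hlen
      omega
    · intro i
      by_cases hi : i.val < o + k
      · exact Or.inr (blockPerm_apply_of_lt ks _ i hi)
      · refine Or.inl (List.formPerm_apply_of_notMem ?_)
        simp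
        omega

theorem isConj_canonicalRep (σ : Equiv.Perm (Fin d)) : IsConj σ (canonicalRep σ) := by
  rw [isConj_iff_cycleType_eq, canonicalRep, cycleType_blockPerm, Multiset.sort_eq]
  · intro k hk
    exact two_le_of_mem_cycleType ((Multiset.mem_sort _).1 hk)
  · rw [← Multiset.sum_coe, Multiset.sort_eq, sum_cycleType, zero_add]
    simpa using σ.support.card_le_univ

/-- The prefix `A` collects the factors already made canonical; the invariant length `k` allows the
next conjugation. -/
theorem exists_canonical_factors (hd : 1 ≤ d) {k : ℕ} (hk : 3 * d ≤ k + 3)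
    (l : List (Equiv.Perm (Fin d))) : ∀ A T : SymFact d, T ∈ transp d → ln T = k →
      factorSubgroup (A * (l.map x).prod * T) = ⊤ →
      ∃ T' ∈ transp d, ln T' = k ∧
        A * (l.map x).prod * T = A * ((l.map canonicalRep).map x).prod * T' := by
  induction l with
  | nil => exact fun A T hT hTk _ => ⟨T, hT, hTk, rfl⟩
  | cons σ l ih =>
    intro A T hT hTk hfull
    obtain ⟨g, hg⟩ := isConj_iff.1 (isConj_canonicalRep σ)
    rw [List.map_cons, List.prod_cons, ← mul_assoc A] at hfull ⊢
    obtain ⟨T₁, h1, h1k, e1⟩ := exists_conj_factor hd hk g A σ _ T hT hTk hfull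
    rw [hg] at e1
    obtain ⟨T₂, h2, h2k, e2⟩ := ih (A * x (canonicalRep σ)) T₁ h1 h1k (e1 ▸ hfull)
    refine ⟨T₂, h2, h2k, ?_⟩
    rw [e1, e2, List.map_cons, List.map_cons, List.prod_cons, ← mul_assoc A]

theorem alpha_prod_map_x (l : List (Equiv.Perm (Fin d))) : alpha (l.map x).prod = l.prod := by
  induction l with
  | nil => simp
  | cons a l ih => rw [List.map_cons, List.prod_cons, map_mul, ih, alpha_x, List.prod_cons]

theorem regen_x (σ : Equiv.Perm (Fin d)) : (regen d (x σ) : SymFact d) = regenElt σ := rfl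

theorem eq_one_of_dim_zero (s : SymFact 0) : s = 1 := by
  induction s using induction_x with
  | h1 => rfl
  | hm a t ih => rw [ih, Subsingleton.elim a 1, x_one, mul_one]

end SymFact

theorem theorem2p3 (d k : ℕ) (l : List (Equiv.Perm (Fin d))) (sbar s : SymFact d)
    (hsbar : sbar ∈ SymFact.transp d)
    (hs : s = (l.map FactSemigroup.x).prod * sbar)
    (hgen : FactSemigroup.factorSubgroup s = ⊤)
    (hlen : FactSemigroup.ln sbar = k)
    (hk : 3 * ((d : ℤ) - 1) ≤ (k : ℤ))
    (σ : Equiv.Perm (Fin d))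
    (hσ : σ = ((l.map SymFact.canonicalRep).prod)⁻¹ * FactSemigroup.alpha s) :
    ∃ g : ℕ,
      (g : ℚ) = ((k : ℚ) - (SymFact.lnt (FactSemigroup.x σ) : ℚ)) / 2 - (d : ℚ) + 1 ∧
      s = ((l.map SymFact.canonicalRep).map FactSemigroup.x).prod
            * (SymFact.regen d (FactSemigroup.x σ) : SymFact d) * SymFact.hurwitz d g := by
  rcases Nat.eq_zero_or_pos d with rfl | hd
  -- For `d = 0` the semigroup is trivial and `k = 0`, so the formula forces `g = 1`.
  · refine ⟨1, ?_, by rw [SymFact.eq_one_of_dim_zero s]; exact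
      (SymFact.eq_one_of_dim_zero _).symm⟩
    rw [SymFact.lnt, SymFact.eq_one_of_dim_zero (SymFact.regen 0 _ : SymFact 0), ← hlen,
      SymFact.eq_one_of_dim_zero sbar, FactSemigroup.ln_one]
    norm_num
  obtain ⟨T, hT, hTk, e⟩ := SymFact.exists_canonical_factors hd (by omega) l 1 sbar hsbar hlen
    (by rw [one_mul, ← hs, hgen])
  rw [one_mul, one_mul, ← hs] at e
  have hα : FactSemigroup.alpha T = σ := by
    rw [hσ, e, map_mul, SymFact.alpha_prod_map_x, inv_mul_cancel_left]
  obtain ⟨g, eg, hg⟩ := SymFact.exists_hurwitz_form hd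
    ((l.map SymFact.canonicalRep).map FactSemigroup.x).prod hT (by omega) (e ▸ hgen)
  rw [hα] at eg hg
  refine ⟨g, ?_, by rw [e, eg, SymFact.regen_x]⟩
  have hg' : (k : ℚ) = FactSemigroup.ln (SymFact.regenElt σ) + 2 * ((d : ℚ) - 1 + g) := by
    rw [← hTk, hg]
    push_cast [Nat.cast_sub hd]
    ring
  rw [SymFact.lnt, SymFact.regen_x, hg']
  ring
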